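/- Let $p$ be a prime, $k$ a field of characteristic $p$, and $K/k$ a purely inseparable field extension of unbounded exponent, i.e. there is no $e\in\mathbb N$ with $K^{p^e}\subseteq k$. Suppose that $K/k$ is $w_0$-generated, i.e. every intermediate field $k\subseteq L\subsetneq K$ has bounded exponent over $k$ ($L^{p^e}\subseteq k$ for some $e\in\mathbb N$). Then $K/k$ is $q$-finite if and only if $lm(K/k)\neq K$. Here: * An extension $K/m$ is modular if for every $n\in\mathbb N$ the fields $K^{p^n}$ and $m$ are linearly disjoint over $K^{p^n}\cap m$; $lm(K/k)$ is the smallest intermediate field $m$ of $K/k$ such that $K/m$ is modular (it exists, because modularity of $K/m$ is preserved under arbitrary intersections of the fields $m$). * An $r$-basis of an extension $K/k$ is a subset $B\subseteq K$ such that $K=k(K^p)(B)$ and $x\notin k(K^p)(B\setminus\{x\})$ for all $x\in B$; every extension of characteristic $p$ has an $r$-basis, and all its $r$-bases have the same cardinality. The degree of irrationality of $K/k$ is the cardinal $di(K/k)=\sup_{n}|B_n|$, where $B_n$ is an $r$-basis of $k_n/k$ and $k_n=\{x\in K : x^{p^n}\in k\}$. The extension $K/k$ is $q$-finite if $di(K/k)$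 is finite. -/

import Mathlib

open Cardinal

universe u

section LinearDisjointness

variable {E : Type u} [Field E]

/-- Two subfields `A`, `B` of a field `E` are linearly disjoint over their intersection `A ∩ B`. -/
def Subfield.LinDisjointOverInf (A B : Subfield E) : Prop :=
  (Subfield.extendScalars (inf_le_left : A ⊓ B ≤ A)).LinearDisjoint
    (Subfield.extendScalars (inf_le_right : A ⊓ B ≤ B))

theorem Subfield.LinDisjointOverInf.linearIndependent {A B : Subfield E}
    (h : A.LinDisjointOverInf B) {ι : Type*} {b : ι → E} (hb : ∀ i, b i ∈ B)
    (hi : LinearIndependent ↥(A ⊓ B) b) : LinearIndependent ↥A b := by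
  have key := IntermediateField.LinearDisjoint.linearIndependent_right h
    (b := fun i => (⟨b i, hb i⟩ : Subfield.extendScalars (inf_le_right : A ⊓ B ≤ B)))
    (LinearIndependent.of_comp
      (Subfield.extendScalars (inf_le_right : A ⊓ B ≤ B)).val.toLinearMap hi)
  exact key

theorem Subfield.LinDisjointOverInf.of_linearIndependent {A B : Subfield E}
    (h : ∀ (ι : Type u) (b : ι → E), (∀ i, b i ∈ B) →
      LinearIndependent ↥(A ⊓ B) b → LinearIndependent ↥A b) : A.LinDisjointOverInf B := by
  let B' := Subfield.extendScalars (inf_le_right : A ⊓ B ≤ B)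
  let b := Module.Basis.ofVectorSpace ↥(A ⊓ B) B'
  refine IntermediateField.LinearDisjoint.of_basis_right b ?_
  exact h _ (fun i => B'.val (b i)) (fun i => (b i).2)
    (b.linearIndependent.map' B'.val.toLinearMap (LinearMap.ker_eq_bot.2 Subtype.val_injective))

/-- Linear disjointness from a fixed subfield passes to arbitrary intersections. -/
theorem Subfield.LinDisjointOverInf.sInf_right {A : Subfield E} {S : Set (Subfield E)}
    (hS : ∀ B ∈ S, A.LinDisjointOverInf B) : A.LinDisjointOverInf (sInf S) := by
  refine .of_linearIndependent fun ι b hb hi => ?_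
  obtain ⟨κ, a, ha, hspan, hli⟩ := exists_linearIndependent' ↥A b
  have hmem : ∀ i, b i ∈ Submodule.span ↥(A ⊓ sInf S) (Set.range (b ∘ a)) := by
    intro i
    have hA : b i ∈ Submodule.span ↥A (Set.range (b ∘ a)) := by
      rw [hspan]; exact Submodule.subset_span ⟨i, rfl⟩
    obtain ⟨l, hl⟩ := (Finsupp.mem_span_range_iff_exists_finsupp).1 hA
    have hcoef : ∀ B ∈ S, ∀ j, (l j : E) ∈ B := by
      intro B hB j
      have hbB : ∀ i, b i ∈ B := fun i => (Subfield.mem_sInf.1 (hb i)) B hB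
      have hliB : LinearIndependent ↥(A ⊓ B) (b ∘ a) := by
        rw [linearIndependent_iff'] at hli ⊢
        intro s g hg t ht
        have := hli s (fun j => ⟨g j, (g j).2.1⟩) hg t ht
        exact Subtype.ext (congrArg (fun x : A => (x : E)) this)
      have hB' : b i ∈ Submodule.span ↥(A ⊓ B) (Set.range (b ∘ a)) := by
        by_contra hn
        have h1 : LinearIndependent ↥(A ⊓ B) (fun o : Option κ => Option.casesOn' o (b i) (b ∘ a)) :=
          (linearIndependent_option').2 ⟨hliB, hn⟩
        have h2 := (hS B hB).linearIndependent (fun o => by cases o <;> simp [hbB]) h1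
        exact ((linearIndependent_option').1 h2).2 hA
      obtain ⟨l', hl'⟩ := (Finsupp.mem_span_range_iff_exists_finsupp).1 hB'
      let f : ↥(A ⊓ B) →+ ↥A := (Subfield.inclusion (inf_le_left : A ⊓ B ≤ A)).toAddMonoidHom
      have heq : Finsupp.mapRange f (map_zero f) l' = l := by
        apply hli.finsuppLinearCombination_injective
        rw [Finsupp.linearCombination_apply, Finsupp.linearCombination_apply, hl, ← hl',
          Finsupp.sum_mapRange_index (by simp)]
        rfl
      rw [← heq]
      exact (l' j).2.2
    have : b i = l.sum fun j c => (c : E) • (b ∘ a) j := hl.symm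
    rw [this]
    refine Submodule.sum_mem _ fun j _ => ?_
    exact Submodule.smul_mem _ (⟨l j, (l j).2, Subfield.mem_sInf.2 fun B hB => hcoef B hB j⟩ :
      ↥(A ⊓ sInf S)) (Submodule.subset_span ⟨j, rfl⟩)
  have hsurj : Function.Surjective a := by
    intro i
    by_contra hn
    refine hi.notMem_span_image (s := Set.range a) (x := i) (by simpa using hn) ?_
    rw [← Set.range_comp]
    exact hmem i
  exact (linearIndependent_equiv (Equiv.ofBijective a ⟨ha, hsurj⟩)).1 hli

end LinearDisjointness

section PurelyInseparable

variable (p : ℕ) [Fact p.Prime] (k K : Type*) [Field k] [Field K] [Algebra k K]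

/-- `K/k` is modular: for every `n`, the subfields `K^{p^n}` and `k` of `K` are linearly disjoint
over their intersection `K^{p^n} ∩ k`. -/
def IsModularExtension [CharP K p] : Prop :=
  ∀ n : ℕ, (iterateFrobenius K p n).fieldRange.LinDisjointOverInf (algebraMap k K).fieldRange

/-- `lm(K/k)`: the smallest intermediate field `m` of `K/k` such that `K/m` is modular. -/
noncomputable def lm [CharP K p] : IntermediateField k K :=
  sInf {m : IntermediateField k K | IsModularExtension p m K}

/-- `lm(K/k)` really is the smallest such intermediate field. -/
theorem lm_isLeast [CharP K p] :
    IsLeast {m : IntermediateField k K | IsModularExtension p m K} (lm p k K) := by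
  have hrange : ∀ m : IntermediateField k K, (algebraMap m K).fieldRange = m.toSubfield := by
    intro m
    ext x
    exact ⟨fun ⟨y, hy⟩ => hy ▸ y.2, fun hx => ⟨⟨x, hx⟩, rfl⟩⟩
  refine ⟨fun n => ?_, fun m hm => sInf_le hm⟩
  have hlm : (lm p k K).toSubfield =
      sInf (IntermediateField.toSubfield '' {m : IntermediateField k K | IsModularExtension p m K}) := by
    rw [lm, IntermediateField.sInf_toSubfield]
  rw [hrange, hlm]
  refine Subfield.LinDisjointOverInf.sInf_right ?_
  rintro _ ⟨m, hm, rfl⟩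
  rw [← hrange]
  exact hm n

/-- `B` is an `r`-basis of `K/k`: a minimal generating set of `K` over `k(K^p)`. -/
def IsRBasis (B : Set K) : Prop :=
  let F : IntermediateField k K := IntermediateField.adjoin k (Set.range fun x : K => x ^ p)
  IntermediateField.adjoin F B = ⊤ ∧
    ∀ x ∈ B, x ∉ IntermediateField.adjoin F (B \ {x})

/-- The cardinality of an `r`-basis of `K/k` (every extension of characteristic `p` has an
`r`-basis, and all its `r`-bases have the same cardinality). -/
noncomputable def rBasisCard : Cardinal :=
  sInf {c : Cardinal | ∃ B : Set K, IsRBasis p k K B ∧ #B = c}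

/-- The intermediate field `k_n = k^{p^{-n}} ∩ K` of all `x ∈ K` with `x ^ (p ^ n) ∈ k`. -/
def rootField [CharP K p] (n : ℕ) : IntermediateField k K :=
  ((algebraMap k K).fieldRange.comap (iterateFrobenius K p n)).toIntermediateField fun x =>
    ⟨x ^ p ^ n, by simp [iterateFrobenius_def]⟩

/-- The degree of irrationality `di(K/k)`: the supremum over `n` of the cardinality of an
`r`-basis of `k_n / k`. -/
noncomputable def irrationalityDegree [CharP K p] : Cardinal :=
  ⨆ n : ℕ, rBasisCard p k (rootField p k K n)

/-- `K/k` is `q`-finite: its degree of irrationality is finite. -/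
def IsQFinite [CharP K p] : Prop :=
  irrationalityDegree p k K < ℵ₀

/-- `K/k` is `w₀`-generated: it is purely inseparable, and every proper intermediate field has
bounded exponent over `k`. -/
def IsW0Generated : Prop :=
  IsPurelyInseparable k K ∧
    ∀ L : IntermediateField k K, L ≠ ⊤ → IsPurelyInseparable.HasExponent k L

end PurelyInseparable

/-!
Write `k_n` for the field of all `x ∈ K` with `x ^ p ^ n ∈ k`, and for an intermediate field `L`
write `k(L^{p^n})` for the field generated over `k` by the `p ^ n`-th powers of the elements of
`L` (`Subfield.rootsIn` and `Subfield.powSup`; all arguments take place among the subfields of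
`K`). An `r`-basis of `L/k` is linearly independent over `k(L^p)`, and a generating set of `d`
elements gives `[L : k(L^p)] ≤ p ^ d`; since `r`-bases exist, by the exchange property of `p`-th
roots, `K/k` is `q`-finite if and only if the degrees `[k_n : k(k_n^p)]` are bounded
(`isQFinite_iff`). The hypothesis enters through its contrapositive: an intermediate field of
unbounded exponent is `K`.

Suppose that these degrees are bounded by `D`. Then every `k_n` is finite over `k`. For fixed `c`
the fields `k((k_{j+c})^{p^j})` decrease with `j` inside the finite extension `k_c`, so they
stabilize at a field `P_c` (`Subfield.stableRoots`). By construction `k(P_{c+1}^p) = P_c`, the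
`P_c` increase, and `P_c` has exponent `c`; hence their union is `K`. The degrees `[P_{c+1} :
P_c]` do not decrease, because passing from `L` to `k(L^p)` turns `P_{c+2}/P_{c+1}` into
`P_{c+1}/P_c` and does not raise degrees (`Subfield.relrank_powSup_le`), and they are bounded by
`D`, because `[L : k(L^p)]` does not grow on passing to an intermediate field
(`Subfield.relrank_powSup_self_le`). So they are equal to a constant `R` from some `c₀` on. For `m
= P_{c₀}`, the fields `P_{c₀+n+j}^{p^n}` exhaust `K^{p^n}`; such a field has degree `R ^ j` over
`P_{c₀+n}^{p^n}`, which is contained in `m`, and its compositum with `m` is `P_{c₀+j}`, which has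
the same degree `R ^ j` over `m`. This equality of degrees means linear disjointness, so `K/m` is
modular, and `m ≠ K` has exponent at most `c₀`: `lm(K/k) ≠ K`
(`Subfield.exists_modular_of_relrank_le`).

Conversely, let `m = lm(K/k) ≠ K`, so that `K/m` is modular and `m^{p^e} ⊆ k` for some `e`. Since
`k(K^{p^n})` has unbounded exponent, it is `K`. Comparing coefficients with the help of linear
disjointness gives `m(m_{n+1}^p) = m_n`. If `m_1/m` were infinite, elements of growing exponents
could be adjoined to `m` one at a time while avoiding a fixed `b ∉ m`, which produces a proper
intermediate field of unbounded exponent. So `R = [m_1 : m]` is finite, and linear disjointness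
gives `[m_{n+1} : m_n] ≤ R`. The fields `Q_n = k(m_n^{p^e})` are finite over `k`, exhaust `K`, and
satisfy `k(Q_{n+1}^p) = Q_n` and `[Q_{n+1} : Q_n] ≤ R`. Since `[L : k(L^p)]` does not grow on
passing to an intermediate field of a finite extension, it is at most `R` for every `L`, in
particular for `k_n` (`Subfield.exists_relrank_le_of_modular`).
-/

/-! ### Degrees of subfields through spanning and independent families -/

namespace Subfield

section Rank

variable {E : Type u} [Field E] {A B : Subfield E}

theorem relrank_le_mk_of_span {ι : Type u} (h : A ≤ B) (b : ι → E)
    (hb : ∀ x ∈ B, x ∈ Submodule.span A (Set.range b)) : relrank A B ≤ #ι := by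
  rw [relrank_eq_rank_of_le h]
  have h1 : (extendScalars h).toSubalgebra.toSubmodule ≤ Submodule.span A (Set.range b) := hb
  calc Module.rank A (extendScalars h) ≤ Module.rank A (Submodule.span A (Set.range b)) :=
        Submodule.rank_mono h1
    _ ≤ #(Set.range b) := rank_span_le _
    _ ≤ #ι := mk_range_le

theorem mk_le_relrank {ι : Type u} (h : A ≤ B) {b : ι → E} (hb : ∀ i, b i ∈ B)
    (hi : LinearIndependent A b) : #ι ≤ relrank A B := by
  rw [relrank_eq_rank_of_le h]
  have : LinearIndependent A (fun i => (⟨b i, hb i⟩ : extendScalars h)) :=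
    LinearIndependent.of_comp (extendScalars h).val.toLinearMap hi
  exact this.cardinal_le_rank

theorem exists_linearIndependent_relrank (h : A ≤ B) : ∃ (ι : Type u) (b : ι → E),
    (∀ i, b i ∈ B) ∧ LinearIndependent A b ∧ (∀ x ∈ B, x ∈ Submodule.span A (Set.range b)) ∧
      #ι = relrank A B := by
  let v := Module.Basis.ofVectorSpace A (extendScalars h)
  refine ⟨_, fun i => (extendScalars h).val (v i), fun i => (v i).2, ?_, fun x hx => ?_, ?_⟩
  · exact v.linearIndependent.map' (extendScalars h).val.toLinearMap
      (LinearMap.ker_eq_bot.2 Subtype.val_injective)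
  · have h1 : (⟨x, hx⟩ : extendScalars h) ∈ Submodule.span A (Set.range v) := by
      rw [v.span_eq]; trivial
    have h2 := Submodule.mem_map_of_mem (f := (extendScalars h).val.toLinearMap) h1
    rw [Submodule.map_span, ← Set.range_comp] at h2
    exact h2
  · rw [relrank_eq_rank_of_le h, v.mk_eq_rank'']

/-- Linear independence over a subfield is inherited by smaller subfields. -/
theorem linearIndependent_of_le (h : A ≤ B) {ι : Type*} {b : ι → E}
    (hi : LinearIndependent B b) : LinearIndependent A b := by
  rw [linearIndependent_iff'] at hi ⊢
  intro s g hg t ht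
  have := hi s (fun j => ⟨g j, h (g j).2⟩) hg t ht
  exact Subtype.ext (congrArg (fun x : B => (x : E)) this)

theorem mem_span_of_le (h : A ≤ B) {s : Set E} {x : E} (hx : x ∈ Submodule.span A s) :
    x ∈ Submodule.span B s := by
  induction hx using Submodule.span_induction with
  | mem x hx => exact Submodule.subset_span hx
  | zero => exact zero_mem _
  | add x y _ _ hx hy => exact add_mem hx hy
  | smul a x _ hx => exact Submodule.smul_mem _ (⟨a, h a.2⟩ : B) hx

theorem one_le_relrank : 1 ≤ relrank A B := by
  rw [relrank, Cardinal.one_le_iff_pos]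
  exact rank_pos

theorem relfinrank_pos_of_lt (h : relrank A B < ℵ₀) : 0 < relfinrank A B := by
  rw [relfinrank_eq_toNat_relrank, Nat.pos_iff_ne_zero]
  intro h0
  rcases Cardinal.toNat_eq_zero.1 h0 with h0 | h0
  · exact absurd (one_le_relrank (A := A) (B := B)) (by simp [h0])
  · exact absurd h (not_lt.2 h0)

theorem cast_relfinrank (h : relrank A B < ℵ₀) : (relfinrank A B : Cardinal) = relrank A B :=
  Cardinal.cast_toNat_of_lt_aleph0 h

theorem relrank_le_of_le_left {C : Subfield E} (h : A ≤ B) (h' : B ≤ C) :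
    relrank B C ≤ relrank A C := by
  rw [← relrank_mul_relrank h h']
  exact le_mul_of_one_le_left' one_le_relrank

theorem relrank_le_of_le_right {C : Subfield E} (h : A ≤ B) (h' : B ≤ C) :
    relrank A B ≤ relrank A C := by
  rw [← relrank_mul_relrank h h']
  exact le_mul_of_one_le_right' one_le_relrank

end Rank

section PurelyInseparable

variable {E : Type u} [Field E] (p : ℕ) [Fact p.Prime]

theorem isAlgebraic_of_pow_mem {A : Subfield E} {x : E} {n : ℕ} (hx : x ^ p ^ n ∈ A) :
    IsAlgebraic A x := by
  have : IsAlgebraic A (x ^ p ^ n) := isAlgebraic_algebraMap (⟨_, hx⟩ : A)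
  exact IsAlgebraic.of_pow (pow_pos (Fact.out : p.Prime).pos n) this

variable {p}

/-- The compositum of `A` and `L` is spanned over `A` by `L`, when `L` is purely inseparable
over `A`. -/
theorem mem_span_of_mem_sup {A L : Subfield E} (hL : ∀ x ∈ L, ∃ n, x ^ p ^ n ∈ A) {z : E}
    (hz : z ∈ A ⊔ L) : z ∈ Submodule.span A (L : Set E) := by
  have h1 : A ⊔ L ≤ (IntermediateField.adjoin A (L : Set E)).toSubfield :=
    sup_le (fun x hx => (IntermediateField.adjoin A (L : Set E)).algebraMap_mem ⟨x, hx⟩)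
      (fun x hx => IntermediateField.subset_adjoin A (L : Set E) hx)
  have h2 : z ∈ (IntermediateField.adjoin A (L : Set E)).toSubalgebra := h1 hz
  rw [IntermediateField.adjoin_toSubalgebra_of_isAlgebraic
    (fun x hx => (hL x hx).elim fun n hn => isAlgebraic_of_pow_mem p hn),
    ← Subalgebra.mem_toSubmodule, Algebra.adjoin_eq_span] at h2
  have h3 : (Submonoid.closure (L : Set E) : Set E) = L := by
    exact congrArg _ (Submonoid.closure_eq L.toSubmonoid)
  rwa [h3] at h2

/-- Degrees do not grow under composition with a fixed field. -/
theorem relrank_sup_sup_le {F L : Subfield E} (h : F ≤ L) (hL : ∀ x ∈ L, ∃ n, x ^ p ^ n ∈ F)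
    (X : Subfield E) : relrank (X ⊔ F) (X ⊔ L) ≤ relrank F L := by
  obtain ⟨ι, b, -, -, hs, hc⟩ := exists_linearIndependent_relrank h
  rw [← hc]
  refine relrank_le_mk_of_span (sup_le_sup_left h X) b fun x hx => ?_
  have h1 : x ∈ (X ⊔ F) ⊔ L := by rwa [sup_assoc, sup_eq_right.2 h]
  have h2 := mem_span_of_mem_sup (fun y hy => (hL y hy).imp fun n hn =>
    (le_sup_right : F ≤ X ⊔ F) hn) h1
  refine Submodule.span_le.2 (fun y hy => ?_) h2
  exact mem_span_of_le le_sup_right (hs y hy)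

/-- A degree criterion for linear disjointness over `F ≤ A ⊓ L`: if `L/F` is finite and purely
inseparable and `[A ⊔ L : A] = [L : F]`, then families in `A` independent over `F` stay independent
over `L`. -/
theorem linearIndependent_of_relrank_sup {F A L : Subfield E} (hFA : F ≤ A) (hFL : F ≤ L)
    (hL : ∀ x ∈ L, ∃ n, x ^ p ^ n ∈ F) (hfin : relrank F L < ℵ₀)
    (heq : relrank A (A ⊔ L) = relrank F L) {ι : Type u} {b : ι → E} (hb : ∀ i, b i ∈ A)
    (hi : LinearIndependent F b) : LinearIndependent L b := by
  obtain ⟨κ, a, ha, hli, hs, hc⟩ := exists_linearIndependent_relrank hFL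
  -- a basis of `L` over `F` spans `A ⊔ L` over `A` and has the right cardinality
  have hκ : Finite κ := Cardinal.lt_aleph0_iff_finite.1 (hc ▸ hfin)
  have := Fintype.ofFinite κ
  have hspan : ∀ x ∈ A ⊔ L, x ∈ Submodule.span A (Set.range a) := fun x hx =>
    Submodule.span_le.2 (fun y hy => mem_span_of_le hFA (hs y hy))
      (mem_span_of_mem_sup (fun y hy => (hL y hy).imp fun n hn => hFA hn) hx)
  let M := extendScalars (le_sup_left : A ≤ A ⊔ L)
  have haM : ∀ i, a i ∈ M := fun i => (le_sup_right : L ≤ A ⊔ L) (ha i)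
  have hliA : LinearIndependent A (fun i => (⟨a i, haM i⟩ : M)) := by
    apply linearIndependent_of_top_le_span_of_card_eq_finrank
    · rintro ⟨x, hx⟩ -
      have h1 := hspan x hx
      have h2 : Submodule.span A (Set.range a) =
          (Submodule.span A (Set.range fun i => (⟨a i, haM i⟩ : M))).map M.val.toLinearMap := by
        rw [Submodule.map_span, ← Set.range_comp]; rfl
      rw [h2] at h1
      obtain ⟨y, hy, hyx⟩ := h1
      have : y = ⟨x, hx⟩ := Subtype.ext hyx
      exact this ▸ hy
    · have h1 : Module.rank A M = #κ := by
        rw [hc, ← heq, relrank_eq_rank_of_le le_sup_left]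
      rw [Module.finrank, h1]; simp
  have h1 : (extendScalars hFL).LinearDisjoint (extendScalars hFA) := by
    let v : Module.Basis κ F (extendScalars hFL) := Module.Basis.mk
      (v := fun i => (⟨a i, ha i⟩ : extendScalars hFL))
      (LinearIndependent.of_comp (extendScalars hFL).val.toLinearMap hli) (by
        rintro ⟨x, hx⟩ -
        have h1 := hs x hx
        have h2 : Submodule.span F (Set.range a) = (Submodule.span F
            (Set.range fun i => (⟨a i, ha i⟩ : extendScalars hFL))).map
              (extendScalars hFL).val.toLinearMap := by
          rw [Submodule.map_span, ← Set.range_comp]; rfl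
        rw [h2] at h1
        obtain ⟨y, hy, hyx⟩ := h1
        have : y = ⟨x, hx⟩ := Subtype.ext hyx
        exact this ▸ hy)
    refine IntermediateField.LinearDisjoint.of_basis_left v ?_
    have h3 := hliA.map' M.val.toLinearMap (LinearMap.ker_eq_bot.2 Subtype.val_injective)
    have h4 : (fun i => ((v i : extendScalars hFL) : E)) = a := by
      funext i
      simp [v]
    have h5 : LinearIndependent A fun i => ((v i : extendScalars hFL) : E) := h4 ▸ h3
    exact h5
  exact IntermediateField.LinearDisjoint.linearIndependent_right h1
    (b := fun i => (⟨b i, hb i⟩ : extendScalars hFA))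
    (LinearIndependent.of_comp (extendScalars hFA).val.toLinearMap hi)

end PurelyInseparable

/-! ### Linearly disjoint subfields -/

section LinDisjoint

variable {E : Type u} [Field E] {A B : Subfield E}

theorem LinDisjointOverInf.linearIndependent_left (h : A.LinDisjointOverInf B) {ι : Type*}
    {b : ι → E} (hb : ∀ i, b i ∈ A) (hi : LinearIndependent ↥(A ⊓ B) b) :
    LinearIndependent ↥B b :=
  IntermediateField.LinearDisjoint.linearIndependent_right
    (IntermediateField.LinearDisjoint.symm h)
    (b := fun i => (⟨b i, hb i⟩ : extendScalars (inf_le_left : A ⊓ B ≤ A)))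
    (LinearIndependent.of_comp
      (extendScalars (inf_le_left : A ⊓ B ≤ A)).val.toLinearMap hi)

/-- If `A` and `B` are linearly disjoint, an element of `B` that is a combination, with
coefficients in `A`, of elements of `B` independent over `A` has its coefficients in `B`. -/
theorem LinDisjointOverInf.coeff_mem (h : A.LinDisjointOverInf B) {κ : Type*} {b : κ → E}
    (hb : ∀ i, b i ∈ B) (hi : LinearIndependent A b) {x : E} (hx : x ∈ B) {l : κ →₀ A}
    (hl : Finsupp.linearCombination A b l = x) (j : κ) : (l j : E) ∈ B := by
  have hi' : LinearIndependent ↥(A ⊓ B) b := linearIndependent_of_le inf_le_left hi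
  have hA : x ∈ Submodule.span A (Set.range b) :=
    Finsupp.mem_span_range_iff_exists_finsupp.2 ⟨l, hl⟩
  have hB : x ∈ Submodule.span ↥(A ⊓ B) (Set.range b) := by
    by_contra hn
    have h1 : LinearIndependent ↥(A ⊓ B) (fun o : Option κ => Option.casesOn' o x b) :=
      linearIndependent_option'.2 ⟨hi', hn⟩
    have h2 := h.linearIndependent (fun o => by cases o <;> simp [hb, hx]) h1
    exact (linearIndependent_option'.1 h2).2 hA
  obtain ⟨l', hl'⟩ := Finsupp.mem_span_range_iff_exists_finsupp.1 hB
  let f : ↥(A ⊓ B) →+ ↥A := (inclusion (inf_le_left : A ⊓ B ≤ A)).toAddMonoidHom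
  have heq : Finsupp.mapRange f (map_zero f) l' = l := by
    apply hi.finsuppLinearCombination_injective
    rw [hl, ← hl', Finsupp.linearCombination_apply, Finsupp.sum_mapRange_index (by simp)]
    rfl
  rw [← heq]
  exact (l' j).2.2

/-- If `A` and `B` are linearly disjoint, then for `A ⊓ B ≤ A' ≤ A` and `B, A' ≤ C` one has
`[A' : A ⊓ B] ≤ [C : B]`. -/
theorem LinDisjointOverInf.relrank_le (h : A.LinDisjointOverInf B) {A' C : Subfield E}
    (h1 : A ⊓ B ≤ A') (h2 : A' ≤ A) (h3 : B ≤ C) (h4 : A' ≤ C) :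
    relrank (A ⊓ B) A' ≤ relrank B C := by
  obtain ⟨ι, b, hb, hli, -, hc⟩ := exists_linearIndependent_relrank h1
  rw [← hc]
  exact mk_le_relrank h3 (fun i => h4 (hb i))
    (h.linearIndependent_left (fun i => h2 (hb i)) hli)

end LinDisjoint

end Subfield

/-! ### Adjoining `p`-th roots -/

namespace Subfield

section Exchange

variable {E : Type u} [Field E] {p : ℕ} [Fact p.Prime] [CharP E p]

theorem sup_closure_eq_adjoin (A : Subfield E) (S : Set E) :
    A ⊔ closure S = (IntermediateField.adjoin A S).toSubfield := by
  refine le_antisymm (sup_le (fun x hx => (IntermediateField.adjoin A S).algebraMap_mem ⟨x, hx⟩)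
    (closure_le.2 (IntermediateField.subset_adjoin A S))) ?_
  have : IntermediateField.adjoin A S ≤ extendScalars (le_sup_left : A ≤ A ⊔ closure S) :=
    IntermediateField.adjoin_le_iff.2 fun x hx =>
      (le_sup_right : closure S ≤ A ⊔ closure S) (subset_closure hx)
  exact this

theorem subset_sup_closure {A : Subfield E} {S : Set E} {x : E} (hx : x ∈ S) :
    x ∈ A ⊔ closure S :=
  (le_sup_right : closure S ≤ A ⊔ closure S) (subset_closure hx)

theorem sup_closure_singleton_of_mem {A : Subfield E} {z : E} (hz : z ∈ A) :
    A ⊔ closure {z} = A :=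
  sup_eq_left.2 (closure_le.2 (Set.singleton_subset_iff.2 hz))

theorem sup_closure_insert (A : Subfield E) (z : E) (S : Set E) :
    A ⊔ closure (insert z S) = (A ⊔ closure S) ⊔ closure {z} := by
  rw [Set.insert_eq, closure_union, sup_comm (closure {z}), sup_assoc]

variable (p) in
/-- Adjoining a `p`-th root which is not already present yields an extension of degree `p`. -/
theorem relrank_sup_closure_singleton {A : Subfield E} {z : E} (hz : z ^ p ∈ A) (hzA : z ∉ A) :
    relrank A (A ⊔ closure {z}) = p := by
  have hp : p.Prime := Fact.out
  let P : Polynomial A := Polynomial.X ^ p - Polynomial.C ⟨z ^ p, hz⟩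
  have hirr : Irreducible P := by
    refine X_pow_sub_C_irreducible_of_prime hp fun b hb => hzA ?_
    have h1 : (b : E) ^ p = z ^ p := congrArg Subtype.val hb
    have h2 : (b : E) = z := frobenius_inj E p h1
    exact h2 ▸ b.2
  have hmon : P.Monic := Polynomial.monic_X_pow_sub_C _ hp.ne_zero
  have hroot : Polynomial.aeval z P = 0 := by
    simp [P, show algebraMap A E ⟨z ^ p, hz⟩ = z ^ p from rfl]
  have hmin : P = minpoly A z := minpoly.eq_of_irreducible_of_monic hirr hroot hmon
  have hint : IsIntegral A z := ⟨P, hmon, hroot⟩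
  have hfin : Module.finrank A (IntermediateField.adjoin A {z}) = p := by
    rw [IntermediateField.adjoin.finrank hint, ← hmin]
    exact Polynomial.natDegree_X_pow_sub_C
  have h1 : extendScalars (le_sup_left : A ≤ A ⊔ closure {z}) = IntermediateField.adjoin A {z} := by
    apply IntermediateField.toSubfield_injective
    rw [← sup_closure_eq_adjoin]
    rfl
  rw [relrank_eq_rank_of_le le_sup_left, h1]
  have := IntermediateField.adjoin.finiteDimensional hint
  rw [← Module.finrank_eq_rank, hfin]

theorem relrank_sup_closure_singleton_le {A : Subfield E} {z : E} (hz : z ^ p ∈ A) :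
    relrank A (A ⊔ closure {z}) ≤ p := by
  by_cases h : z ∈ A
  · rw [sup_closure_singleton_of_mem h, relrank_self]
    exact_mod_cast (Fact.out : p.Prime).one_le
  · exact (relrank_sup_closure_singleton p hz h).le

/-- The exchange property of `p`-th roots: if `z ^ p ∈ A` and `b ∈ A(z)` is not in `A`,
then `z ∈ A(b)`. -/
theorem mem_sup_closure_exchange {A : Subfield E} {z b : E} (hz : z ^ p ∈ A) (hbA : b ∉ A)
    (hb : b ∈ A ⊔ closure {z}) : z ∈ A ⊔ closure {b} := by
  have hp : p.Prime := Fact.out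
  have hzA : z ∉ A := fun h => hbA (by rwa [sup_closure_singleton_of_mem h] at hb)
  have h1 : A ⊔ closure {b} ≤ A ⊔ closure {z} :=
    sup_le le_sup_left (closure_le.2 (Set.singleton_subset_iff.2 hb))
  have h2 := relfinrank_mul_relfinrank (le_sup_left : A ≤ A ⊔ closure {b}) h1
  have h3 : relfinrank A (A ⊔ closure {z}) = p := by
    rw [relfinrank_eq_toNat_relrank, relrank_sup_closure_singleton p hz hzA]; simp
  rw [h3] at h2
  rcases (Nat.dvd_prime hp).1 (Dvd.intro _ h2) with h4 | h4
  · exact absurd (relfinrank_eq_one_iff.1 h4 (subset_sup_closure rfl)) hbA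
  · rw [h4] at h2
    have h5 := Nat.eq_of_mul_eq_mul_left hp.pos (h2.trans (mul_one p).symm)
    exact relfinrank_eq_one_iff.1 h5 (subset_sup_closure rfl)

theorem relrank_sup_closure_le {A : Subfield E} (S : Finset E) (hS : ∀ s ∈ S, s ^ p ∈ A) :
    relrank A (A ⊔ closure (S : Set E)) ≤ ((p ^ S.card : ℕ) : Cardinal) := by
  classical
  induction S using Finset.induction_on with
  | empty => simp
  | insert z S hz ih =>
    rw [Finset.coe_insert, sup_closure_insert, ← relrank_mul_relrank
      (le_sup_left : A ≤ A ⊔ closure (S : Set E)) le_sup_left, Finset.card_insert_of_notMem hz,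
      pow_succ, Nat.cast_mul]
    exact mul_le_mul' (ih fun s hs => hS s (Finset.mem_insert_of_mem hs))
      (relrank_sup_closure_singleton_le
        ((le_sup_left : A ≤ _) (hS z (Finset.mem_insert_self _ _))))

omit [CharP E p] in
variable (p) in
theorem relrank_sup_closure_singleton_lt_aleph0 {A : Subfield E} {z : E} {n : ℕ}
    (hz : z ^ p ^ n ∈ A) : relrank A (A ⊔ closure {z}) < ℵ₀ := by
  have h1 : extendScalars (le_sup_left : A ≤ A ⊔ closure {z}) = IntermediateField.adjoin A {z} := by
    apply IntermediateField.toSubfield_injective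
    rw [← sup_closure_eq_adjoin]
    rfl
  rw [relrank_eq_rank_of_le le_sup_left, h1]
  have := IntermediateField.adjoin.finiteDimensional (isAlgebraic_of_pow_mem p hz).isIntegral
  exact Module.rank_lt_aleph0 _ _

theorem relrank_lt_aleph0_trans {A B C : Subfield E} (h1 : A ≤ B) (h2 : B ≤ C)
    (h3 : relrank A B < ℵ₀) (h4 : relrank B C < ℵ₀) : relrank A C < ℵ₀ := by
  rw [← relrank_mul_relrank h1 h2]
  exact mul_lt_aleph0 h3 h4

/-- An element `z`, purely inseparable over `A`, which lies in `A(z ^ p)` already lies in `A`. -/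
theorem mem_of_mem_sup_closure_pow {A : Subfield E} {z : E} {n : ℕ} (hz : z ^ p ^ n ∈ A)
    (h : z ∈ A ⊔ closure {z ^ p}) : z ∈ A := by
  -- raising to the power `p` gives `z ^ p ^ i ∈ A(z ^ p ^ (i + 1))` for all `i`
  have key : ∀ i, A ⊔ closure {z} ≤ A ⊔ closure {z ^ p ^ i} := by
    intro i
    induction i with
    | zero => simp
    | succ i ih =>
      refine ih.trans (sup_le le_sup_left (closure_le.2 (Set.singleton_subset_iff.2 ?_)))
      have h1 : (A ⊔ closure {z ^ p}).map (iterateFrobenius E p i) ≤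
          A ⊔ closure {z ^ p ^ (i + 1)} := by
        rw [map_le_iff_le_comap]
        refine sup_le (fun x hx => ?_) (closure_le.2 (Set.singleton_subset_iff.2 ?_))
        · rw [mem_comap, iterateFrobenius_def]
          exact pow_mem ((le_sup_left : A ≤ A ⊔ closure {z ^ p ^ (i + 1)}) hx) _
        · rw [SetLike.mem_coe, mem_comap, iterateFrobenius_def, ← pow_mul, ← pow_succ']
          exact subset_sup_closure rfl
      have h2 := h1 (mem_map.2 ⟨z, h, rfl⟩)
      rwa [iterateFrobenius_def] at h2
  have h1 := key n (subset_sup_closure rfl)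
  rwa [sup_closure_singleton_of_mem hz] at h1

/-- If `y` has the same exponent `n + 1` over `L` and over `L(b)`, then adjoining `y` to `L` does
not produce `b`. -/
theorem notMem_sup_closure_singleton {L : Subfield E} {b y : E} {n : ℕ} (hbL : b ∉ L)
    (hy : y ^ p ^ (n + 1) ∈ L) (hyb : y ^ p ^ n ∉ L ⊔ closure {b}) : b ∉ L ⊔ closure {y} := by
  have key : ∀ i ≤ n + 1, b ∉ L ⊔ closure {y ^ p ^ (n + 1 - i)} := by
    intro i
    induction i with
    | zero => intro _; rwa [Nat.sub_zero, sup_closure_singleton_of_mem hy]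
    | succ i ih =>
      intro hi hb
      obtain ⟨j, rfl⟩ := Nat.exists_eq_add_of_le (Nat.le_of_succ_le_succ hi)
      have e1 : i + j + 1 - i = j + 1 := by omega
      have e2 : i + j + 1 - (i + 1) = j := by omega
      rw [e2] at hb
      rw [e1] at ih
      set w := y ^ p ^ j with hw
      have hwp : y ^ p ^ (j + 1) = w ^ p := by rw [hw, ← pow_mul, pow_succ]
      rw [hwp] at ih
      have hbw : b ∈ (L ⊔ closure {w ^ p}) ⊔ closure {w} :=
        (sup_le_sup_right le_sup_left _ : L ⊔ closure {w} ≤ _) hb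
      have hwL : w ^ p ∈ L ⊔ closure {w ^ p} := subset_sup_closure rfl
      have h1 := mem_sup_closure_exchange hwL (ih (by omega)) hbw
      rw [sup_assoc, sup_comm (closure {w ^ p}), ← sup_assoc] at h1
      have h2 : w ∈ L ⊔ closure {b} := by
        refine mem_of_mem_sup_closure_pow (n := i + 1) (p := p) ?_ h1
        refine (le_sup_left : L ≤ L ⊔ closure {b}) ?_
        rw [hw, ← pow_mul, ← pow_add]
        rwa [show j + (i + 1) = i + j + 1 by omega]
      apply hyb
      rw [show i + j = j + i by omega, pow_add, pow_mul]
      exact pow_mem h2 _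
  simpa using key (n + 1) le_rfl

end Exchange

/-! ### The fields `F(L^{p^n})` and `F^{p^{-n}}` -/

section PowSup

variable {E : Type u} [Field E] (p : ℕ) [Fact p.Prime] [CharP E p]

/-- The subfield `F(L^{p^n})`. -/
def powSup (F : Subfield E) (n : ℕ) (L : Subfield E) : Subfield E :=
  F ⊔ L.map (iterateFrobenius E p n)

/-- The subfield `F^{p^{-n}}` of all `x` with `x ^ p ^ n ∈ F`. -/
def rootsIn (F : Subfield E) (n : ℕ) : Subfield E :=
  F.comap (iterateFrobenius E p n)

variable {p} {F L A B : Subfield E} {m n : ℕ} {x : E}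

theorem mem_rootsIn : x ∈ rootsIn p F n ↔ x ^ p ^ n ∈ F := by
  rw [rootsIn, mem_comap, iterateFrobenius_def]

theorem pow_mem_map (hx : x ∈ L) : x ^ p ^ n ∈ L.map (iterateFrobenius E p n) :=
  mem_map.2 ⟨x, hx, iterateFrobenius_def p n x⟩

theorem mem_map_iterateFrobenius :
    x ∈ L.map (iterateFrobenius E p n) ↔ ∃ y ∈ L, y ^ p ^ n = x := by
  simp [mem_map, iterateFrobenius_def]

theorem pow_mem_powSup (hx : x ∈ L) : x ^ p ^ n ∈ powSup p F n L :=
  (le_sup_right : _ ≤ powSup p F n L) (pow_mem_map hx)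

theorem pow_mem_powSup_one_top (x : E) : x ^ p ∈ powSup p F 1 ⊤ := by
  simpa using pow_mem_powSup (p := p) (n := 1) (F := F) (mem_top x)

theorem le_powSup : F ≤ powSup p F n L := le_sup_left

theorem powSup_mono (h : A ≤ B) : powSup p F n A ≤ powSup p F n B :=
  sup_le_sup_left ((gc_map_comap _).monotone_l h) _

theorem powSup_le (h : F ≤ B) (h' : ∀ x ∈ L, x ^ p ^ n ∈ B) : powSup p F n L ≤ B :=
  sup_le h fun x hx => by
    obtain ⟨y, hy, rfl⟩ := mem_map_iterateFrobenius.1 hx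
    exact h' y hy

theorem powSup_le_self (h : F ≤ L) : powSup p F n L ≤ L :=
  powSup_le h fun _ hx => pow_mem hx _

theorem powSup_zero (h : F ≤ L) : powSup p F 0 L = L := by
  refine le_antisymm (powSup_le_self h) fun x hx => ?_
  simpa using pow_mem_powSup (p := p) (F := F) (n := 0) hx

/-- `F(A(L^{p^m})^{p^n}) = F(L^{p^{m+n}})` as soon as `A^{p^n} ⊆ F`. -/
theorem powSup_powSup_of_pow_mem (h : ∀ x ∈ A, x ^ p ^ n ∈ F) :
    powSup p F n (powSup p A m L) = powSup p F (m + n) L := by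
  refine le_antisymm ?_ (powSup_le le_powSup fun x hx => ?_)
  · have h1 : powSup p A m L ≤ (powSup p F (m + n) L).comap (iterateFrobenius E p n) := by
      refine powSup_le (fun x hx => ?_) fun x hx => ?_
      · rw [mem_comap, iterateFrobenius_def]; exact le_powSup (h x hx)
      · rw [mem_comap, iterateFrobenius_def, ← pow_mul, ← pow_add]; exact pow_mem_powSup hx
    exact sup_le le_powSup (map_le_iff_le_comap.2 h1)
  · rw [pow_add, pow_mul]
    exact pow_mem_powSup (pow_mem_powSup hx)

theorem powSup_powSup : powSup p F n (powSup p F m L) = powSup p F (m + n) L :=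
  powSup_powSup_of_pow_mem fun _ hx => pow_mem hx _

theorem le_rootsIn : F ≤ rootsIn p F n := fun _ hx => mem_rootsIn.2 (pow_mem hx _)

theorem rootsIn_mono (h : m ≤ n) : rootsIn p F m ≤ rootsIn p F n := fun x hx => by
  obtain ⟨j, rfl⟩ := Nat.exists_eq_add_of_le h
  rw [mem_rootsIn, pow_add, pow_mul]
  exact pow_mem (mem_rootsIn.1 hx) _

theorem rootsIn_zero : rootsIn p F 0 = F := by
  ext x; simp [mem_rootsIn]

theorem powSup_rootsIn_le : powSup p F m (rootsIn p F (m + n)) ≤ rootsIn p F n :=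
  powSup_le le_rootsIn fun x hx => by
    rw [mem_rootsIn, ← pow_mul, ← pow_add]; exact mem_rootsIn.1 hx

theorem powSup_rootsIn_self : powSup p F n (rootsIn p F n) = F :=
  le_antisymm (powSup_le le_rfl fun _ hx => mem_rootsIn.1 hx) le_powSup

theorem relrank_powSup_le (h : A ≤ B) (hB : ∀ x ∈ B, ∃ n, x ^ p ^ n ∈ A) :
    relrank (powSup p F n A) (powSup p F n B) ≤ relrank A B := by
  rw [← relrank_map_map A B (iterateFrobenius E p n)]
  refine relrank_sup_sup_le (p := p) ((gc_map_comap _).monotone_l h) (fun x hx => ?_) F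
  obtain ⟨y, hy, rfl⟩ := mem_map_iterateFrobenius.1 hx
  obtain ⟨j, hj⟩ := hB y hy
  exact ⟨j, by rw [← pow_mul, mul_comm, pow_mul]; exact pow_mem_map hj⟩

/-- For a finite purely inseparable extension `L/F`, the degree `[L : F(L^p)]` does not grow
when `L` is replaced by an intermediate field: this follows from
`[F(L^p) : F(A^p)] ≤ [L : A]`. -/
theorem relrank_powSup_self_le (hFA : F ≤ A) (hAL : A ≤ L) (hfin : relrank F L < ℵ₀)
    (hL : ∀ x ∈ L, ∃ n, x ^ p ^ n ∈ F) :
    relrank (powSup p F 1 A) A ≤ relrank (powSup p F 1 L) L := by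
  have hGA : powSup p F 1 A ≤ A := powSup_le_self hFA
  have hGL : powSup p F 1 L ≤ L := powSup_le_self (hFA.trans hAL)
  have h1 : relrank (powSup p F 1 A) (powSup p F 1 L) ≤ relrank A L :=
    relrank_powSup_le hAL fun x hx => (hL x hx).imp fun n hn => hFA hn
  have f0 : relrank (powSup p F 1 A) L < ℵ₀ :=
    (relrank_le_of_le_left le_powSup (hGA.trans hAL)).trans_lt hfin
  have f1 : relrank (powSup p F 1 A) A < ℵ₀ := (relrank_le_of_le_right hGA hAL).trans_lt f0
  have f2 : relrank A L < ℵ₀ := (relrank_le_of_le_left hGA hAL).trans_lt f0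
  have f3 : relrank (powSup p F 1 L) L < ℵ₀ :=
    (relrank_le_of_le_left (powSup_mono hAL) hGL).trans_lt f0
  have f4 : relrank (powSup p F 1 A) (powSup p F 1 L) < ℵ₀ := h1.trans_lt f2
  have e : relfinrank (powSup p F 1 A) A * relfinrank A L =
      relfinrank (powSup p F 1 A) (powSup p F 1 L) * relfinrank (powSup p F 1 L) L := by
    rw [relfinrank_mul_relfinrank hGA hAL, relfinrank_mul_relfinrank (powSup_mono hAL) hGL]
  rw [← cast_relfinrank f1, ← cast_relfinrank f3, Nat.cast_le]
  rw [← cast_relfinrank f4, ← cast_relfinrank f2, Nat.cast_le] at h1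
  refine Nat.le_of_mul_le_mul_right ?_ (relfinrank_pos_of_lt f2)
  rw [e, mul_comm]
  exact Nat.mul_le_mul_left _ h1

end PowSup

end Subfield

/-! ### From finiteness to modularity -/

namespace Subfield

section StableRoots

variable {E : Type u} [Field E] (p : ℕ) [Fact p.Prime] [CharP E p] {F : Subfield E}

theorem relrank_rootsIn_lt_aleph0 {D n : ℕ}
    (hD : relrank (powSup p F 1 (rootsIn p F n)) (rootsIn p F n) ≤ D) :
    relrank F (rootsIn p F n) < ℵ₀ := by
  -- each step of the tower `F(L^{p^j})`, `j ≤ n`, has degree at most `D`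
  have key : ∀ j, relrank (powSup p F j (rootsIn p F n)) (rootsIn p F n) < ℵ₀ := by
    intro j
    induction j with
    | zero => rw [powSup_zero le_rootsIn, relrank_self]; exact one_lt_aleph0
    | succ j ih =>
      refine relrank_lt_aleph0_trans (B := powSup p F j (rootsIn p F n)) ?_
        (powSup_le_self le_rootsIn) ?_ ih
      · rw [add_comm, ← powSup_powSup]
        exact powSup_mono (powSup_le_self le_rootsIn)
      · rw [add_comm, ← powSup_powSup]
        refine (relrank_powSup_le (powSup_le_self le_rootsIn) fun x hx => ⟨n, ?_⟩).trans_lt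
          (hD.trans_lt (natCast_lt_aleph0))
        exact le_powSup (mem_rootsIn.1 hx)
  simpa only [powSup_rootsIn_self] using key n

/-- A decreasing sequence of finite extensions of `F` is eventually constant. -/
theorem exists_forall_eq_of_antitone {X : ℕ → Subfield E} (hX : Antitone X) (hF : ∀ j, F ≤ X j)
    (hfin : relrank F (X 0) < ℵ₀) : ∃ J, ∀ j ≥ J, X j = X J := by
  have hfin' : ∀ j, relrank F (X j) < ℵ₀ := fun j =>
    (relrank_le_of_le_right (hF j) (hX (Nat.zero_le j))).trans_lt hfin
  let J := Function.argmin (fun j => relfinrank F (X j))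
  refine ⟨J, fun j hj => le_antisymm (hX hj) (relfinrank_eq_one_iff.1 ?_)⟩
  have h1 := relfinrank_mul_relfinrank (hF j) (hX hj)
  have h2 : relfinrank F (X J) ≤ relfinrank F (X j) :=
    Function.argmin_le (fun j => relfinrank F (X j)) j
  have h3 := relfinrank_pos_of_lt (hfin' j)
  have h4 := relfinrank_pos_of_lt (hfin' J)
  have h5 : 0 < relfinrank (X j) (X J) := Nat.pos_of_ne_zero fun h => by simp [h] at h1; omega
  have h6 : relfinrank F (X j) * relfinrank (X j) (X J) ≤ relfinrank F (X j) * 1 := by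
    rw [h1, mul_one]; exact h2
  exact le_antisymm (Nat.le_of_mul_le_mul_left h6 h3) h5

/-- The intersection of the decreasing sequence of fields `F((F^{p^{-(j+c)}})^{p^j})`; it is their
eventual value when `F^{p^{-c}}` is finite over `F`. Its elements have exponent at most `c`
over `F`. -/
def stableRoots (F : Subfield E) (c : ℕ) : Subfield E :=
  ⨅ j, powSup p F j (rootsIn p F (j + c))

theorem antitone_powSup_rootsIn (c : ℕ) :
    Antitone fun j => powSup p F j (rootsIn p F (j + c)) := by
  refine antitone_nat_of_succ_le fun j => ?_
  rw [add_comm j 1, ← powSup_powSup]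
  refine powSup_mono ?_
  rw [add_assoc]
  exact powSup_rootsIn_le

theorem le_stableRoots (c : ℕ) : F ≤ stableRoots p F c :=
  le_iInf fun _ => le_powSup

theorem stableRoots_le_rootsIn (c : ℕ) : stableRoots p F c ≤ rootsIn p F c :=
  (iInf_le _ 0).trans powSup_rootsIn_le

theorem stableRoots_mono : Monotone (stableRoots p F) := fun _ _ h =>
  iInf_mono fun _ => powSup_mono (rootsIn_mono (Nat.add_le_add_left h _))

variable {p}

theorem exists_stableRoots_eq (hfin : ∀ n, relrank F (rootsIn p F n) < ℵ₀) (c : ℕ) :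
    ∃ J, ∀ j ≥ J, stableRoots p F c = powSup p F j (rootsIn p F (j + c)) := by
  obtain ⟨J, hJ⟩ := exists_forall_eq_of_antitone (antitone_powSup_rootsIn p (F := F) c)
    (fun _ => le_powSup) (by
      simp only [powSup_zero le_rootsIn, zero_add]; exact hfin c)
  refine ⟨J, fun j hj => le_antisymm (iInf_le _ j) (le_iInf fun i => ?_)⟩
  have h1 : powSup p F j (rootsIn p F (j + c)) = powSup p F (i + J) (rootsIn p F (i + J + c)) :=
    (hJ j hj).trans (hJ (i + J) (by omega)).symm
  rw [h1]
  exact antitone_powSup_rootsIn p c (by omega)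

theorem powSup_one_stableRoots (hfin : ∀ n, relrank F (rootsIn p F n) < ℵ₀) (c : ℕ) :
    powSup p F 1 (stableRoots p F (c + 1)) = stableRoots p F c := by
  obtain ⟨J, hJ⟩ := exists_stableRoots_eq hfin c
  obtain ⟨J', hJ'⟩ := exists_stableRoots_eq hfin (c + 1)
  rw [hJ' (J + J') (by omega), hJ (J + J' + 1) (by omega), powSup_powSup]
  congr 2
  omega

theorem powSup_stableRoots (hfin : ∀ n, relrank F (rootsIn p F n) < ℵ₀) (c n : ℕ) :
    powSup p F n (stableRoots p F (c + n)) = stableRoots p F c := by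
  induction n with
  | zero => exact powSup_zero (le_stableRoots p c)
  | succ n ih =>
    rw [add_comm n 1, ← powSup_powSup, add_comm 1 n, ← add_assoc, powSup_one_stableRoots hfin, ih]

/-- Unless `E/F` has bounded exponent, `stableRoots (c + 1)` has exponent exactly `c + 1`. -/
theorem exists_mem_stableRoots (hfin : ∀ n, relrank F (rootsIn p F n) < ℵ₀)
    (hpi : ∀ x : E, ∃ n, x ^ p ^ n ∈ F) (hunb : ∀ n, ∃ x : E, x ^ p ^ n ∉ F) (c : ℕ) :
    ∃ x ∈ stableRoots p F (c + 1), x ^ p ^ c ∉ F := by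
  classical
  obtain ⟨J, hJ⟩ := exists_stableRoots_eq hfin (c + 1)
  obtain ⟨z, hz⟩ := hunb (J + c)
  -- a suitable power of `z` has exponent exactly `J + c + 1`
  let N := Nat.find (hpi z)
  have hN : z ^ p ^ N ∈ F := Nat.find_spec (hpi z)
  have hlt : J + c < N := by
    by_contra h
    apply hz
    obtain ⟨i, hi⟩ := Nat.exists_eq_add_of_le (not_lt.1 h)
    rw [hi, pow_add, pow_mul]
    exact pow_mem hN _
  obtain ⟨i, hi⟩ := Nat.exists_eq_add_of_lt hlt
  refine ⟨(z ^ p ^ i) ^ p ^ J, ?_, ?_⟩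
  · rw [hJ J le_rfl]
    refine pow_mem_powSup (mem_rootsIn.2 ?_)
    rw [← pow_mul, ← pow_add, show i + (J + (c + 1)) = N by omega]
    exact hN
  · rw [← pow_mul, ← pow_add, ← pow_mul, ← pow_add]
    exact Nat.find_min (hpi z) (show i + (J + c) < N by omega)

theorem relrank_stableRoots_succ_lt_aleph0 (hfin : ∀ n, relrank F (rootsIn p F n) < ℵ₀) (c : ℕ) :
    relrank (stableRoots p F c) (stableRoots p F (c + 1)) < ℵ₀ :=
  (relrank_le_of_le_left (le_stableRoots p c) (stableRoots_mono p (Nat.le_succ c))).trans_lt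
    ((relrank_le_of_le_right (le_stableRoots p _) (stableRoots_le_rootsIn p _)).trans_lt
      (hfin (c + 1)))

/-- The degrees of consecutive `stableRoots` do not decrease, since `L ↦ F(L^p)` shifts the index
by one and does not raise degrees. -/
theorem monotone_relfinrank_stableRoots (hfin : ∀ n, relrank F (rootsIn p F n) < ℵ₀) :
    Monotone fun c => relfinrank (stableRoots p F c) (stableRoots p F (c + 1)) := by
  have f := relrank_stableRoots_succ_lt_aleph0 hfin
  refine monotone_nat_of_le_succ fun c => ?_
  rw [← Nat.cast_le (α := Cardinal.{u}), cast_relfinrank (f _), cast_relfinrank (f _)]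
  have h := relrank_powSup_le (F := F) (n := 1) (stableRoots_mono p (F := F) (Nat.le_succ (c + 1)))
    fun x hx => ⟨_, le_stableRoots p _ (mem_rootsIn.1 (stableRoots_le_rootsIn p _ hx))⟩
  rwa [powSup_one_stableRoots hfin c, powSup_one_stableRoots hfin (c + 1)] at h

/-- From some index on, all the degrees `[stableRoots (c + 1) : stableRoots c]` agree. -/
theorem exists_relrank_stableRoots_eq_pow {D : ℕ}
    (hD : ∀ n, relrank (powSup p F 1 (rootsIn p F n)) (rootsIn p F n) ≤ D) :
    ∃ R c₀ : ℕ, ∀ c ≥ c₀, ∀ j,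
      relrank (stableRoots p F c) (stableRoots p F (c + j)) = ((R ^ j : ℕ) : Cardinal) := by
  have hfin := fun n => relrank_rootsIn_lt_aleph0 p (hD n)
  have f := relrank_stableRoots_succ_lt_aleph0 hfin
  let r := fun c => relfinrank (stableRoots p F c) (stableRoots p F (c + 1))
  have hr : Monotone r := monotone_relfinrank_stableRoots hfin
  have hb : ∀ c, r c ≤ D := fun c => by
    rw [← Nat.cast_le (α := Cardinal.{u}), cast_relfinrank (f c)]
    refine le_trans ?_ (hD (c + 1))
    conv_lhs => rw [← powSup_one_stableRoots hfin c]
    exact relrank_powSup_self_le (le_stableRoots p _) (stableRoots_le_rootsIn p _) (hfin _)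
      fun x hx => ⟨_, mem_rootsIn.1 hx⟩
  obtain ⟨c₀, hc₀⟩ : ∃ c₀, ∀ c ≥ c₀, r c = r c₀ := by
    have hne : (Set.range r).Nonempty := Set.range_nonempty r
    have hbd : BddAbove (Set.range r) := ⟨D, by rintro _ ⟨c, rfl⟩; exact hb c⟩
    obtain ⟨c₀, h⟩ := Nat.sSup_mem hne hbd
    exact ⟨c₀, fun c hc => le_antisymm (h ▸ le_csSup hbd ⟨c, rfl⟩) (hr hc)⟩
  refine ⟨r c₀, c₀, fun c hc j => ?_⟩
  induction j with
  | zero => simp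
  | succ j ih =>
    rw [← add_assoc, ← relrank_mul_relrank (stableRoots_mono p (Nat.le_add_right c j))
      (stableRoots_mono p (Nat.le_succ (c + j))), ih, pow_succ, Nat.cast_mul,
      ← hc₀ (c + j) (by omega), cast_relfinrank (f _)]

/-- If the `stableRoots` exhaust the field and have constant relative degrees from the index `c₀`
on, then the extension is modular over `stableRoots c₀`. -/
theorem linDisjointOverInf_stableRoots (hfin : ∀ n, relrank F (rootsIn p F n) < ℵ₀) {R c₀ : ℕ}
    (hR : ∀ c ≥ c₀, ∀ j,
      relrank (stableRoots p F c) (stableRoots p F (c + j)) = ((R ^ j : ℕ) : Cardinal))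
    (htop : ∀ x : E, ∃ c, x ∈ stableRoots p F c) (n : ℕ) :
    (iterateFrobenius E p n).fieldRange.LinDisjointOverInf (stableRoots p F c₀) := by
  set m := stableRoots p F c₀ with hm
  set φ := iterateFrobenius E p n with hφ
  let A : ℕ → Subfield E := fun j => (stableRoots p F (c₀ + n + j)).map φ
  have hA0 : A 0 ≤ φ.fieldRange ⊓ m := by
    refine le_inf ?_ ?_
    · rintro _ ⟨x, -, rfl⟩; exact ⟨x, rfl⟩
    · rw [hm, ← powSup_stableRoots hfin c₀ n]
      exact le_sup_right
  have hAmono : Monotone A := fun i j h =>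
    (gc_map_comap φ).monotone_l (stableRoots_mono p (Nat.add_le_add_left h _))
  have hAj : ∀ j {ι : Type u} {b : ι → E}, (∀ i, b i ∈ m) → LinearIndependent (A 0) b →
      LinearIndependent (A j) b := by
    intro j ι b hb hi
    have h1 : relrank (A 0) (A j) = ((R ^ j : ℕ) : Cardinal) := by
      rw [← hR (c₀ + n) (by omega) j]
      exact relrank_map_map _ _ φ
    have h2 : m ⊔ A j = stableRoots p F (c₀ + j) := by
      rw [← powSup_stableRoots hfin (c₀ + j) n, powSup, add_right_comm]
      refine le_antisymm (sup_le ?_ le_sup_right) (sup_le_sup_right (le_stableRoots p c₀) _)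
      rw [hm, ← powSup_stableRoots hfin c₀ n, powSup]
      exact sup_le_sup_left (hAmono (Nat.zero_le j)) F
    refine linearIndependent_of_relrank_sup (p := p) (hA0.trans inf_le_right)
      (hAmono (Nat.zero_le j)) ?_ (h1 ▸ natCast_lt_aleph0) ?_ hb hi
    · rintro _ ⟨x, hx, rfl⟩
      refine ⟨c₀ + n + j, ?_⟩
      rw [hφ, iterateFrobenius_def, ← pow_mul, mul_comm, pow_mul]
      exact pow_mem_map (le_stableRoots p _ (mem_rootsIn.1 (stableRoots_le_rootsIn p _ hx)))
    · rw [h2, h1]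
      exact hR c₀ le_rfl j
  refine .of_linearIndependent fun ι b hb hi => ?_
  have hi0 : LinearIndependent (A 0) b := linearIndependent_of_le hA0 hi
  -- a linear relation over `K^{p^n}` involves only finitely many coefficients
  rw [linearIndependent_iff']
  intro s g hg t ht
  have hex : ∀ i, ∃ j, (g i : E) ∈ A j := by
    intro i
    obtain ⟨x, hx⟩ := (g i).2
    obtain ⟨c, hc⟩ := htop x
    exact ⟨c, mem_map.2 ⟨x, stableRoots_mono p (Nat.le_add_left c _) hc, hx⟩⟩
  choose J hJ using hex
  let N := s.sup J
  have hN : ∀ i ∈ s, (g i : E) ∈ A N := fun i hi => hAmono (Finset.le_sup hi) (hJ i)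
  classical
  have h2 := linearIndependent_iff'.1 (hAj N hb hi0) s
    (fun i => if h : i ∈ s then ⟨g i, hN i h⟩ else 0) (by
      rw [← hg]
      refine Finset.sum_congr rfl fun i hi => ?_
      rw [dif_pos hi]
      rfl) t ht
  rw [dif_pos ht] at h2
  exact Subtype.ext (congrArg (fun x : A N => (x : E)) h2)

end StableRoots

variable {E : Type u} [Field E] {p : ℕ} [Fact p.Prime] [CharP E p] {F : Subfield E}

theorem mem_iSup_of_monotone {X : ℕ → Subfield E} (hX : Monotone X) {x : E} :
    x ∈ ⨆ i, X i ↔ ∃ i, x ∈ X i :=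
  mem_iSup_of_directed (hX.directed_le)

/-- Let `E/F` be purely inseparable of unbounded exponent, such that every proper intermediate
field has bounded exponent. If the degrees `[L : F(L^p)]` with `L = F^{p^{-n}}` are bounded, then
`E` is modular over a proper intermediate field. -/
theorem exists_modular_of_relrank_le (hpi : ∀ x : E, ∃ n, x ^ p ^ n ∈ F)
    (hunb : ∀ n, ∃ x : E, x ^ p ^ n ∉ F)
    (hw : ∀ L, F ≤ L → (∀ n, ∃ x ∈ L, x ^ p ^ n ∉ F) → L = ⊤) {D : ℕ}
    (hD : ∀ n, relrank (powSup p F 1 (rootsIn p F n)) (rootsIn p F n) ≤ D) :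
    ∃ m, F ≤ m ∧ m ≠ ⊤ ∧ ∀ n, (iterateFrobenius E p n).fieldRange.LinDisjointOverInf m := by
  have hfin := fun n => relrank_rootsIn_lt_aleph0 p (hD n)
  have htop : ⨆ c, stableRoots p F c = ⊤ := by
    refine hw _ ((le_stableRoots p 0).trans (le_iSup _ 0)) fun n => ?_
    obtain ⟨x, hx, hxn⟩ := exists_mem_stableRoots hfin hpi hunb n
    exact ⟨x, le_iSup (stableRoots p F) (n + 1) hx, hxn⟩
  obtain ⟨R, c₀, hR⟩ := exists_relrank_stableRoots_eq_pow hD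
  refine ⟨stableRoots p F c₀, le_stableRoots p c₀, fun h => ?_, linDisjointOverInf_stableRoots
    hfin hR fun x => (mem_iSup_of_monotone (stableRoots_mono p)).1 (htop ▸ mem_top x)⟩
  obtain ⟨x, hx⟩ := hunb c₀
  exact hx (mem_rootsIn.1 (stableRoots_le_rootsIn p c₀ (h ▸ mem_top x)))

end Subfield

/-! ### From modularity to finiteness -/

namespace Subfield

section Modular

variable {E : Type u} [Field E] {p : ℕ} [Fact p.Prime] [CharP E p] {F m : Subfield E}

theorem linearIndependent_map {A : Subfield E} {ι : Type*} {b : ι → E}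
    (hi : LinearIndependent A b) (f : E →+* E) :
    LinearIndependent (A.map f) fun i => f (b i) := by
  rw [linearIndependent_iff'] at hi ⊢
  intro s g hg t ht
  have hex : ∀ i, ∃ a : A, f a = g i := fun i => by
    obtain ⟨x, hx, hxg⟩ := mem_map.1 (g i).2
    exact ⟨⟨x, hx⟩, hxg⟩
  choose a ha using hex
  have h1 : ∑ i ∈ s, a i • b i = 0 := by
    apply f.injective
    rw [map_zero, map_sum, ← hg]
    refine Finset.sum_congr rfl fun i _ => ?_
    rw [Algebra.smul_def, Algebra.smul_def, map_mul]
    exact congrArg (· * f (b i)) (ha i)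
  apply Subtype.ext
  rw [← ha t, hi s a h1 t ht]
  simp

/-- If `E/m` is modular and `E = m(E^p)`, then `m^{p^{-n}}` is generated over `m` by the `p`-th
powers of the elements of `m^{p^{-(n+1)}}`. -/
theorem powSup_one_rootsIn
    (hmod : ∀ n, (iterateFrobenius E p n).fieldRange.LinDisjointOverInf m)
    (htop : powSup p m 1 ⊤ = ⊤) (n : ℕ) :
    powSup p m 1 (rootsIn p m (n + 1)) = rootsIn p m n := by
  refine le_antisymm (add_comm 1 n ▸ powSup_rootsIn_le) fun x hx => ?_
  set A : Subfield E := (⊤ : Subfield E).map (iterateFrobenius E p 1) with hA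
  set φ := iterateFrobenius E p n with hφ
  -- expand `x` in a family of elements of `m` that is independent over `E^p`
  have h1 : x ∈ Submodule.span A (m : Set E) := by
    refine mem_span_of_mem_sup (p := p) (fun y _ => ⟨1, pow_mem_map (mem_top y)⟩) ?_
    rw [sup_comm]
    exact (le_of_eq htop.symm : ⊤ ≤ powSup p m 1 ⊤) (mem_top x)
  obtain ⟨b, hbm, hbs, hbi⟩ := exists_linearIndependent A (m : Set E)
  rw [← hbs, ← Subtype.range_coe (s := b), Finsupp.mem_span_range_iff_exists_finsupp] at h1
  obtain ⟨l, hl⟩ := h1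
  have hmem : ∀ a : A, φ a ∈ (iterateFrobenius E p (n + 1)).fieldRange := by
    rintro ⟨_, ⟨y, -, rfl⟩⟩
    refine ⟨y, ?_⟩
    change _ = φ (iterateFrobenius E p 1 y)
    rw [hφ, iterateFrobenius_def, iterateFrobenius_def, iterateFrobenius_def, ← pow_mul, ← pow_add,
      add_comm]
  let f : A →+* (iterateFrobenius E p (n + 1)).fieldRange :=
    (φ.comp A.subtype).codRestrict _ hmem
  have hle : (iterateFrobenius E p (n + 1)).fieldRange ≤ A.map φ := by
    rintro _ ⟨y, rfl⟩
    refine mem_map.2 ⟨iterateFrobenius E p 1 y, mem_map.2 ⟨y, mem_top y, rfl⟩, ?_⟩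
    rw [hφ, iterateFrobenius_def, iterateFrobenius_def, iterateFrobenius_def, ← pow_mul, ← pow_add,
      add_comm]
  have hli := linearIndependent_of_le hle (linearIndependent_map hbi φ)
  -- after raising to the power `p ^ n`, the coefficients lie in `m` by linear disjointness
  have hcoef : ∀ i, (l i : E) ^ p ^ n ∈ m := by
    intro i
    have h2 := (hmod (n + 1)).coeff_mem (b := fun i : b => φ (i : E))
      (fun i => by rw [hφ, iterateFrobenius_def]; exact pow_mem (hbm i.2) _) hli
      (mem_rootsIn.1 hx) (l := Finsupp.mapRange f (map_zero f) l) (by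
        rw [Finsupp.linearCombination_apply, Finsupp.sum_mapRange_index (by simp), ← hl,
          ← iterateFrobenius_def, map_finsuppSum]
        refine Finsupp.sum_congr fun i _ => ?_
        rw [Algebra.smul_def, Algebra.smul_def, map_mul]
        rfl) i
    rw [Finsupp.mapRange_apply] at h2
    rw [← iterateFrobenius_def]
    exact h2
  rw [← hl]
  refine sum_mem fun i _ => ?_
  refine mul_mem (s := powSup p m 1 (rootsIn p m (n + 1))) ?_ (le_powSup (hbm i.2))
  obtain ⟨y, -, hy⟩ := mem_map_iterateFrobenius.1 (l i).2
  rw [← hy]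
  refine pow_mem_powSup (mem_rootsIn.2 ?_)
  rw [add_comm, pow_add, pow_mul, hy]
  exact hcoef i

theorem powSup_rootsIn
    (hmod : ∀ n, (iterateFrobenius E p n).fieldRange.LinDisjointOverInf m)
    (htop : powSup p m 1 ⊤ = ⊤) (j n : ℕ) :
    powSup p m n (rootsIn p m (j + n)) = rootsIn p m j := by
  induction n with
  | zero => exact powSup_zero le_rootsIn
  | succ n ih =>
    rw [add_comm n 1, ← powSup_powSup, add_comm 1 n, ← add_assoc, powSup_one_rootsIn hmod htop, ih]

/-- Let `E/m` be modular with `E = m(E^p) ≠ m`, such that every proper intermediate field has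
bounded exponent. Then the elements of exponent at most one form a finite extension of `m`:
otherwise elements of growing exponents can be adjoined to `m` one after the other without ever
reaching a given `b`, and they generate a proper intermediate field of unbounded exponent. -/
theorem relrank_rootsIn_one_lt_aleph0
    (hmod : ∀ n, (iterateFrobenius E p n).fieldRange.LinDisjointOverInf m) (hm : m ≠ ⊤)
    (hpi : ∀ x : E, ∃ n, x ^ p ^ n ∈ m) (htop : powSup p m 1 ⊤ = ⊤)
    (hw : ∀ L, m ≤ L → (∀ n, ∃ x ∈ L, x ^ p ^ n ∉ m) → L = ⊤) :
    relrank m (rootsIn p m 1) < ℵ₀ := by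
  by_contra hinf
  obtain ⟨b, hb⟩ : ∃ b, b ∉ m := by
    by_contra! h
    exact hm (eq_top_iff.2 fun x _ => h x)
  let S := {L : Subfield E // m ≤ L ∧ relrank m L < ℵ₀ ∧ b ∉ L}
  have step : ∀ (n : ℕ) (L : S), ∃ L' : S, L.1 ≤ L'.1 ∧ ∃ y ∈ L'.1, y ^ p ^ n ∉ m := by
    rintro n ⟨L, hmL, hL, hbL⟩
    obtain ⟨N, hN⟩ := hpi b
    have hLb : relrank m (L ⊔ closure {b}) < ℵ₀ := relrank_lt_aleph0_trans hmL le_sup_left hL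
      (relrank_sup_closure_singleton_lt_aleph0 p (hmL hN))
    have hmLb : m ≤ L ⊔ closure {b} := hmL.trans le_sup_left
    obtain ⟨y, hy, hyb⟩ : ∃ y ∈ rootsIn p m (1 + n), y ^ p ^ n ∉ L ⊔ closure {b} := by
      by_contra! h
      apply hinf
      refine (relrank_le_of_le_right (le_rootsIn (p := p)) ?_).trans_lt hLb
      rw [← powSup_rootsIn hmod htop 1 n]
      exact powSup_le hmLb h
    have hy' : y ^ p ^ (n + 1) ∈ m := by rw [add_comm]; exact mem_rootsIn.1 hy
    refine ⟨⟨L ⊔ closure {y}, hmL.trans le_sup_left, relrank_lt_aleph0_trans hmL le_sup_left hL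
      (relrank_sup_closure_singleton_lt_aleph0 p (hmL hy')),
      notMem_sup_closure_singleton hbL (hmL hy') hyb⟩, le_sup_left, y, subset_sup_closure rfl,
      fun h => hyb (hmLb h)⟩
  choose next hle hex using step
  let X : ℕ → S := fun n => Nat.rec ⟨m, le_rfl, by simp, hb⟩ next n
  have hmono : Monotone fun n => (X n).1 := monotone_nat_of_le_succ fun n => hle n (X n)
  have h1 : ⨆ n, (X n).1 = ⊤ := by
    refine hw _ ((X 0).2.1.trans (le_iSup (fun n => (X n).1) 0)) fun n => ?_
    obtain ⟨y, hy, hyn⟩ := hex n (X n)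
    exact ⟨y, le_iSup (fun n => (X n).1) (n + 1) hy, hyn⟩
  obtain ⟨n, hn⟩ := (mem_iSup_of_monotone hmono).1 (h1 ▸ mem_top b)
  exact (X n).2.2.2 hn

/-- After raising to the power `p ^ n`, the extension becomes one over `E^{p^n} ∩ m`; by linear
disjointness its degree does not drop on passing to `m`, where it lands in `m^{p^{-1}}`. -/
theorem relrank_rootsIn_succ_le
    (hmod : ∀ n, (iterateFrobenius E p n).fieldRange.LinDisjointOverInf m) (n : ℕ) :
    relrank (rootsIn p m n) (rootsIn p m (n + 1)) ≤ relrank m (rootsIn p m 1) := by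
  rw [← relrank_map_map _ _ (iterateFrobenius E p n)]
  have h1 : (rootsIn p m n).map (iterateFrobenius E p n) =
      (iterateFrobenius E p n).fieldRange ⊓ m := by
    rw [rootsIn, map_comap_eq, inf_comm]
  rw [h1]
  refine (hmod n).relrank_le ?_ ?_ le_rootsIn ?_
  · rw [← h1]
    exact (gc_map_comap _).monotone_l (rootsIn_mono (Nat.le_succ n))
  · rintro _ ⟨x, -, rfl⟩; exact ⟨x, rfl⟩
  · rintro _ ⟨x, hx, rfl⟩
    rw [iterateFrobenius_def, mem_rootsIn, ← pow_mul, ← pow_add]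
    exact mem_rootsIn.1 hx

/-- If `E` is the union of an increasing sequence of finite extensions `Q n` of `F` with
`[Q n : F((Q n)^p)] ≤ R`, then `[L : F(L^p)] ≤ R` for every intermediate field `L`. -/
theorem relrank_powSup_le_of_iUnion (hpi : ∀ x : E, ∃ n, x ^ p ^ n ∈ F) {Q : ℕ → Subfield E}
    (hQ : Monotone Q) (htop : ∀ x, ∃ n, x ∈ Q n) (hFQ : ∀ n, F ≤ Q n)
    (hfin : ∀ n, relrank F (Q n) < ℵ₀) {R : ℕ} (hR : ∀ n, relrank (powSup p F 1 (Q n)) (Q n) ≤ R)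
    {L : Subfield E} (hL : F ≤ L) : relrank (powSup p F 1 L) L ≤ R := by
  rw [relrank_eq_rank_of_le (powSup_le_self hL)]
  refine rank_le fun s hs => ?_
  -- a finite independent family generates a finite extension of `F`, inside some `Q n`
  let S : Set E := Subtype.val '' (s : Set (extendScalars (powSup_le_self (p := p) (n := 1) hL)))
  let M := F ⊔ closure S
  have hSL : S ⊆ L := by rintro _ ⟨x, -, rfl⟩; exact x.2
  have hML : M ≤ L := sup_le hL (closure_le.2 hSL)
  choose N hN using htop
  have hMQ : ∃ n, M ≤ Q n := by
    refine ⟨s.sup fun x => N (x : E), sup_le (hFQ _) (closure_le.2 ?_)⟩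
    rintro _ ⟨x, hx, rfl⟩
    exact hQ (Finset.le_sup (f := fun x : extendScalars _ => N (x : E)) (Finset.mem_coe.1 hx))
      (hN x)
  obtain ⟨n, hn⟩ := hMQ
  have h1 : relrank (powSup p F 1 M) M ≤ R :=
    (relrank_powSup_self_le le_sup_left hn (hfin n) fun x _ => hpi x).trans (hR n)
  have h2 : LinearIndependent (powSup p F 1 L) fun i : s => ((i : extendScalars
      (powSup_le_self (p := p) (n := 1) hL)) : E) :=
    hs.map' (extendScalars (powSup_le_self (p := p) (n := 1) hL)).val.toLinearMap
      (LinearMap.ker_eq_bot.2 Subtype.val_injective)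
  have h3 := mk_le_relrank (powSup_le_self (p := p) (n := 1) (le_sup_left : F ≤ M))
    (fun i : s => subset_sup_closure (A := F) (S := S) ⟨i.1, i.2, rfl⟩)
    (linearIndependent_of_le (powSup_mono hML) h2)
  have h4 := h3.trans h1
  rw [Cardinal.mk_coe_finset] at h4
  exact_mod_cast h4

/-- Let `E/F` be purely inseparable of unbounded exponent, such that every proper intermediate
field has bounded exponent. If `E` is modular over a proper intermediate field, then the degrees
`[L : F(L^p)]`, with `L` an intermediate field, are bounded. -/
theorem exists_relrank_le_of_modular (hpi : ∀ x : E, ∃ n, x ^ p ^ n ∈ F)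
    (hunb : ∀ n, ∃ x : E, x ^ p ^ n ∉ F)
    (hw : ∀ L, F ≤ L → (∀ n, ∃ x ∈ L, x ^ p ^ n ∉ F) → L = ⊤) (hFm : F ≤ m) (hm : m ≠ ⊤)
    (hmod : ∀ n, (iterateFrobenius E p n).fieldRange.LinDisjointOverInf m) :
    ∃ R : ℕ, ∀ L, F ≤ L → relrank (powSup p F 1 L) L ≤ R := by
  have htop : ∀ n, powSup p F n ⊤ = ⊤ := fun n => hw _ le_powSup fun i => by
    obtain ⟨z, hz⟩ := hunb (n + i)
    exact ⟨z ^ p ^ n, pow_mem_powSup (mem_top z), by rwa [← pow_mul, ← pow_add]⟩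
  have htopm : powSup p m 1 ⊤ = ⊤ := top_le_iff.1 ((htop 1).ge.trans (sup_le_sup_right hFm _))
  obtain ⟨e, he⟩ : ∃ e, ∀ x ∈ m, x ^ p ^ e ∈ F := by
    by_contra! h
    exact hm (hw m hFm h)
  have hpim : ∀ x : E, ∃ n, x ^ p ^ n ∈ m := fun x => (hpi x).imp fun n hn => hFm hn
  have hwm : ∀ L, m ≤ L → (∀ n, ∃ x ∈ L, x ^ p ^ n ∉ m) → L = ⊤ := fun L hL h =>
    hw L (hFm.trans hL) fun n => (h n).imp fun x hx => ⟨hx.1, fun h' => hx.2 (hFm h')⟩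
  have hfin := relrank_rootsIn_one_lt_aleph0 hmod hm hpim htopm hwm
  obtain ⟨R, hR⟩ := Cardinal.lt_aleph0.1 hfin
  -- the fields `Q n = F((m^{p^{-n}})^{p^e})` satisfy `F((Q (n + 1))^p) = Q n`
  let Q : ℕ → Subfield E := fun n => powSup p F e (rootsIn p m n)
  have hQ : Monotone Q := fun i j h => powSup_mono (rootsIn_mono h)
  have hQ0 : Q 0 = F := by
    refine le_antisymm (powSup_le le_rfl fun x hx => ?_) le_powSup
    exact he x (by rwa [rootsIn_zero] at hx)
  have hQs : ∀ n, powSup p F 1 (Q (n + 1)) = Q n := fun n => by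
    change _ = powSup p F e (rootsIn p m n)
    rw [← powSup_one_rootsIn hmod htopm n, powSup_powSup_of_pow_mem he, powSup_powSup, add_comm]
  have hQr : ∀ n, relrank (Q n) (Q (n + 1)) ≤ R := fun n =>
    ((relrank_powSup_le (rootsIn_mono (Nat.le_succ n)) fun x _ =>
      (hpim x).imp fun _ h => le_rootsIn h).trans (relrank_rootsIn_succ_le hmod n)).trans hR.le
  have hR1 : (1 : Cardinal) ≤ R := hR ▸ one_le_relrank
  refine ⟨R, fun L hL => relrank_powSup_le_of_iUnion hpi hQ (fun x => ?_) (fun n => le_powSup)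
    (fun n => ?_) (fun n => ?_) hL⟩
  · have h1 : ⨆ n, Q n = ⊤ := by
      refine top_le_iff.1 ((htop e).ge.trans (powSup_le (hQ0.ge.trans (le_iSup Q 0)) fun x _ => ?_))
      obtain ⟨n, hn⟩ := hpim x
      exact le_iSup Q n (pow_mem_powSup (mem_rootsIn.2 hn))
    exact (mem_iSup_of_monotone hQ).1 (h1 ▸ mem_top x)
  · induction n with
    | zero => rw [hQ0, relrank_self]; exact one_lt_aleph0
    | succ n ih =>
      exact relrank_lt_aleph0_trans le_powSup (hQ (Nat.le_succ n)) ih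
        ((hQr n).trans_lt natCast_lt_aleph0)
  · cases n with
    | zero => rw [hQ0, le_antisymm (powSup_le_self le_rfl) le_powSup, relrank_self]; exact hR1
    | succ n => rw [hQs]; exact hQr n

end Modular

end Subfield

/-! ### `r`-bases -/

namespace Subfield

section RBasis

variable {L : Type u} [Field L] {p : ℕ} [Fact p.Prime] [CharP L p]

/-- When every `p`-th power lies in `A`, there is a minimal generating set of `L` over `A`: a
maximal set none of whose elements is generated over `A` by the others. -/
theorem exists_minimal_generating {A : Subfield L} (hA : ∀ x : L, x ^ p ∈ A) :
    ∃ B : Set L, A ⊔ closure B = ⊤ ∧ ∀ x ∈ B, x ∉ A ⊔ closure (B \ {x}) := by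
  obtain ⟨B, hB⟩ := zorn_subset {S : Set L | ∀ x ∈ S, x ∉ A ⊔ closure (S \ {x})} (by
    intro c hc hchain
    rcases c.eq_empty_or_nonempty with rfl | hne
    · exact ⟨∅, by simp, by simp⟩
    refine ⟨⋃₀ c, ?_, fun s hs => Set.subset_sUnion_of_mem hs⟩
    rintro x ⟨s₀, hs₀, hx₀⟩ hx
    have := hne.to_subtype
    have hdir : Directed (· ≤ ·) fun s : c => A ⊔ closure ((s : Set L) \ {x}) := by
      intro s t
      rcases hchain.total s.2 t.2 with h | h
      · exact ⟨t, sup_le_sup_left (closure_mono (Set.sdiff_subset_sdiff_left h)) A, le_rfl⟩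
      · exact ⟨s, le_rfl, sup_le_sup_left (closure_mono (Set.sdiff_subset_sdiff_left h)) A⟩
    have hle : A ⊔ closure (⋃₀ c \ {x}) ≤ ⨆ s : c, A ⊔ closure ((s : Set L) \ {x}) := by
      refine sup_le (le_trans le_sup_left (le_iSup (fun s : c => A ⊔ closure ((s : Set L) \ {x}))
        ⟨s₀, hs₀⟩)) (closure_le.2 ?_)
      rintro y ⟨⟨s, hs, hys⟩, hyx⟩
      exact le_iSup (fun s : c => A ⊔ closure ((s : Set L) \ {x})) ⟨s, hs⟩
        (subset_sup_closure ⟨hys, hyx⟩)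
    obtain ⟨⟨s, hs⟩, hxs⟩ := (mem_iSup_of_directed hdir).1 (hle hx)
    rcases hchain.total hs hs₀ with h | h
    · exact hc hs₀ x hx₀ (sup_le_sup_left (closure_mono (Set.sdiff_subset_sdiff_left h)) A hxs)
    · exact hc hs x (h hx₀) hxs)
  refine ⟨B, eq_top_iff.2 fun x _ => ?_, hB.prop⟩
  by_contra hx
  have hxB : x ∉ B := fun h => hx (subset_sup_closure h)
  -- by exchange, `insert x B` would contradict the maximality of `B`
  refine hxB (hB.le_of_ge (y := insert x B) ?_ (Set.subset_insert x B) (Set.mem_insert x B))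
  rintro y (rfl | hy)
  · rwa [Set.insert_sdiff_of_mem _ (Set.mem_singleton y), Set.sdiff_singleton_eq_self hxB]
  · have hyx : x ≠ y := fun h => hxB (h ▸ hy)
    intro hmem
    rw [Set.insert_sdiff_of_notMem _ (by simpa using hyx), sup_closure_insert] at hmem
    have h1 := mem_sup_closure_exchange ((le_sup_left : A ≤ A ⊔ closure (B \ {y})) (hA x))
      (hB.prop y hy) hmem
    rw [← sup_closure_insert, Set.insert_sdiff_singleton, Set.insert_eq_of_mem hy] at h1
    exact hx h1

/-- A set none of whose elements is generated over `A` by the others is linearly independent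
over `A`. -/
theorem mk_le_relrank_of_notMem {A : Subfield L} {B : Set L}
    (hB : ∀ x ∈ B, x ∉ A ⊔ closure (B \ {x})) : #B ≤ relrank A ⊤ := by
  refine mk_le_relrank le_top (b := fun x : B => (x : L)) (fun x => mem_top _) ?_
  rw [linearIndependent_iff_notMem_span]
  intro x hx
  refine hB x x.2 ?_
  have h1 : Submodule.span A ((fun x : B => (x : L)) '' (Set.univ \ {x})) ≤
      (extendScalars (le_sup_left : A ≤ A ⊔ closure (B \ {↑x}))).toSubalgebra.toSubmodule := by
    rw [Submodule.span_le]
    rintro _ ⟨y, ⟨-, hy⟩, rfl⟩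
    exact subset_sup_closure (A := A) ⟨y.2, fun h => hy (Subtype.ext h)⟩
  exact h1 hx

theorem map_powSup {E : Type u} [Field E] [CharP E p] (f : L →+* E) (F A : Subfield L) (n : ℕ) :
    (powSup p F n A).map f = powSup p (F.map f) n (A.map f) := by
  rw [powSup, powSup, map_sup, map_map, map_map, RingHom.iterateFrobenius_comm]

end RBasis

end Subfield

section

variable (p : ℕ) [Fact p.Prime] (k L : Type*) [Field k] [Field L] [Algebra k L] [CharP L p]

theorem toSubfield_adjoin_range_pow :
    (IntermediateField.adjoin k (Set.range fun x : L => x ^ p)).toSubfield =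
      Subfield.powSup p (algebraMap k L).fieldRange 1 ⊤ := by
  refine le_antisymm ?_ (Subfield.powSup_le ?_ fun x _ => ?_)
  · refine Subfield.closure_le.2 (Set.union_subset ?_ ?_)
    · rintro _ ⟨x, rfl⟩
      exact Subfield.le_powSup ⟨x, rfl⟩
    · rintro _ ⟨x, rfl⟩
      exact Subfield.pow_mem_powSup_one_top x
  · rintro _ ⟨x, rfl⟩
    exact IntermediateField.algebraMap_mem _ x
  · rw [pow_one]
    exact IntermediateField.subset_adjoin k _ ⟨x, rfl⟩

variable {p k L}

theorem isRBasis_iff {B : Set L} : IsRBasis p k L B ↔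
    Subfield.powSup p (algebraMap k L).fieldRange 1 ⊤ ⊔ Subfield.closure B = ⊤ ∧
      ∀ x ∈ B, x ∉ Subfield.powSup p (algebraMap k L).fieldRange 1 ⊤ ⊔
        Subfield.closure (B \ {x}) := by
  have h : ∀ S : Set L, Subfield.powSup p (algebraMap k L).fieldRange 1 ⊤ ⊔ Subfield.closure S =
      (IntermediateField.adjoin (IntermediateField.adjoin k (Set.range fun x : L => x ^ p))
        S).toSubfield := fun S => by
    rw [← toSubfield_adjoin_range_pow p k L, Subfield.sup_closure_eq_adjoin]
    rfl
  simp only [h]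
  rw [IsRBasis]
  refine and_congr ?_ Iff.rfl
  rw [← IntermediateField.toSubfield_inj]
  rfl

theorem exists_isRBasis : ∃ B : Set L, IsRBasis p k L B := by
  simp only [isRBasis_iff]
  exact Subfield.exists_minimal_generating Subfield.pow_mem_powSup_one_top

theorem rBasisCard_le_relrank :
    rBasisCard p k L ≤ (Subfield.powSup p (algebraMap k L).fieldRange 1 ⊤).relrank ⊤ := by
  obtain ⟨B, hB⟩ := exists_isRBasis (p := p) (k := k) (L := L)
  exact (show rBasisCard p k L ≤ #B from csInf_le' ⟨B, hB, rfl⟩).trans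
    (Subfield.mk_le_relrank_of_notMem (isRBasis_iff.1 hB).2)

theorem relrank_le_of_rBasisCard_le {N : ℕ} (h : rBasisCard p k L ≤ N) :
    (Subfield.powSup p (algebraMap k L).fieldRange 1 ⊤).relrank ⊤ ≤ ((p ^ N : ℕ) : Cardinal) := by
  obtain ⟨B, hB, hc⟩ : rBasisCard p k L ∈ {c : Cardinal | ∃ B : Set L, IsRBasis p k L B ∧ #B = c} :=
    csInf_mem (exists_isRBasis.elim fun B hB => ⟨_, B, hB, rfl⟩)
  rw [← hc] at h
  have hfin : B.Finite := Cardinal.lt_aleph0_iff_set_finite.1 (h.trans_lt natCast_lt_aleph0)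
  obtain ⟨S, rfl⟩ := hfin.exists_finset_coe
  have hS : S.card ≤ N := by
    rw [Finset.coe_sort_coe, Cardinal.mk_coe_finset] at h
    exact_mod_cast h
  have h1 := (isRBasis_iff.1 hB).1
  have h2 := Subfield.relrank_sup_closure_le S fun x _ =>
    Subfield.pow_mem_powSup_one_top (F := (algebraMap k L).fieldRange) (p := p) x
  rw [h1] at h2
  exact h2.trans (Nat.cast_le.2 (Nat.pow_le_pow_right (Fact.out : p.Prime).pos hS))

end

section

variable {p : ℕ} [Fact p.Prime] {k K : Type*} [Field k] [Field K] [Algebra k K] [CharP K p]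

theorem relrank_powSup_rootField (n : ℕ) :
    (Subfield.powSup p (algebraMap k (rootField p k K n)).fieldRange 1 ⊤).relrank ⊤ =
      (Subfield.powSup p (algebraMap k K).fieldRange 1
        (Subfield.rootsIn p (algebraMap k K).fieldRange n)).relrank
          (Subfield.rootsIn p (algebraMap k K).fieldRange n) := by
  have h1 : (⊤ : Subfield (rootField p k K n)).map (rootField p k K n).val.toRingHom =
      Subfield.rootsIn p (algebraMap k K).fieldRange n := by
    ext x
    exact ⟨fun ⟨y, _, hy⟩ => hy ▸ y.2, fun hx => ⟨⟨x, hx⟩, Subfield.mem_top _, rfl⟩⟩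
  have h2 : (algebraMap k (rootField p k K n)).fieldRange.map (rootField p k K n).val.toRingHom =
      (algebraMap k K).fieldRange := by
    rw [RingHom.map_fieldRange]
    rfl
  rw [← Subfield.relrank_map_map _ _ (rootField p k K n).val.toRingHom, Subfield.map_powSup, h1, h2]

theorem isQFinite_iff : IsQFinite p k K ↔ ∃ D : ℕ, ∀ n,
    (Subfield.powSup p (algebraMap k K).fieldRange 1
      (Subfield.rootsIn p (algebraMap k K).fieldRange n)).relrank
        (Subfield.rootsIn p (algebraMap k K).fieldRange n) ≤ D := by
  simp only [← relrank_powSup_rootField]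
  constructor
  · intro h
    obtain ⟨N, hN⟩ := Cardinal.lt_aleph0.1 h
    refine ⟨p ^ N, fun n => relrank_le_of_rBasisCard_le ?_⟩
    rw [← hN]
    exact le_ciSup (f := fun n => rBasisCard p k (rootField p k K n)) Cardinal.bddAbove_of_small n
  · rintro ⟨D, hD⟩
    exact (ciSup_le' fun n => rBasisCard_le_relrank.trans (hD n)).trans_lt natCast_lt_aleph0

theorem isModularExtension_iff (m : IntermediateField k K) : IsModularExtension p m K ↔
    ∀ n, (iterateFrobenius K p n).fieldRange.LinDisjointOverInf m.toSubfield := by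
  have h : (algebraMap m K).fieldRange = m.toSubfield := by
    ext x
    exact ⟨fun ⟨y, hy⟩ => hy ▸ y.2, fun hx => ⟨⟨x, hx⟩, rfl⟩⟩
  rw [IsModularExtension, h]

end

/-! ### The characterization of `q`-finiteness -/

theorem mainTheorem1 (p : ℕ) [Fact p.Prime] (k K : Type*) [Field k] [Field K] [Algebra k K]
    [CharP k p] [CharP K p] (hw : IsW0Generated k K)
    (hexp : ¬ IsPurelyInseparable.HasExponent k K) :
    IsQFinite p k K ↔ lm p k K ≠ ⊤ := by
  have := hw.1
  have : ExpChar k p := ExpChar.prime Fact.out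
  set F := (algebraMap k K).fieldRange with hF
  have hpi : ∀ x : K, ∃ n, x ^ p ^ n ∈ F := fun x => IsPurelyInseparable.pow_mem k p x
  have hunb : ∀ n, ∃ x : K, x ^ p ^ n ∉ F := by
    by_contra! h
    exact hexp ((IsPurelyInseparable.hasExponent_iff' k K p).2 h)
  have hw' : ∀ L, F ≤ L → (∀ n, ∃ x ∈ L, x ^ p ^ n ∉ F) → L = ⊤ := by
    intro L hFL hL
    let L' : IntermediateField k K := L.toIntermediateField fun x => hFL ⟨x, rfl⟩
    by_contra hne
    have hL' : L' ≠ ⊤ := fun h => hne (eq_top_iff.2 fun x _ =>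
      (h ▸ IntermediateField.mem_top : x ∈ L'))
    obtain ⟨e, he⟩ := (IsPurelyInseparable.hasExponent_iff' k L' p).1 (hw.2 L' hL')
    obtain ⟨x, hx, hxe⟩ := hL e
    obtain ⟨y, hy⟩ := he ⟨x, hx⟩
    exact hxe ⟨y, congrArg Subtype.val hy⟩
  rw [isQFinite_iff]
  constructor
  · rintro ⟨D, hD⟩ htop
    obtain ⟨m, hFm, hm, hmod⟩ := Subfield.exists_modular_of_relrank_le hpi hunb hw' hD
    let m' : IntermediateField k K := m.toIntermediateField fun x => hFm ⟨x, rfl⟩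
    have h1 : lm p k K ≤ m' := (lm_isLeast p k K).2 ((isModularExtension_iff m').2 hmod)
    exact hm (eq_top_iff.2 fun x _ => h1 (htop ▸ IntermediateField.mem_top))
  · intro hne
    obtain ⟨R, hR⟩ := Subfield.exists_relrank_le_of_modular hpi hunb hw'
      (m := (lm p k K).toSubfield) (fun _ ⟨x, hx⟩ => hx ▸ (lm p k K).algebraMap_mem x)
      (fun h => hne (IntermediateField.toSubfield_injective h))
      ((isModularExtension_iff _).1 (lm_isLeast p k K).1)
    exact ⟨R, fun n => hR _ Subfield.le_rootsIn⟩
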